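/- Let $p>2$ be a prime, let $G=\langle\sigma\rangle$ be cyclic of order $p$, and let $A=\bigoplus_{k=0}^{p-1}\mathbb{F}_p\tau^k$ with $\tau^p=1$ be the free $\mathbb{F}_p[G]$-module of rank one on which $\sigma$ acts as multiplication by $\tau$. Let $A_i\subseteq A$ be the submodule generated by $(\tau-1)^i$. For $1\le i\le p$ and $e\in\mathbb{F}_p$ let $B_{i,e}$ be the extension of $A/A_i$ by $G$ in which $\sigma$ has a (fixed) lift $\tilde\sigma$ with $\tilde\sigma^{\,p}=e(\tau-1)^{i-1}$; thus $B_{i,0}=(A/A_i)\rtimes G$. For $i>j\ge 1$ there is a natural surjection $B_{i,e}\to (A/A_j)\rtimes G$ with kernel $A_j/A_i$, induced by the projection $A/A_i\to A/A_j$ and sending $\tilde\sigma$ to $\sigma$. Let $K/F$ be a cyclic extension of degree $p$ with $\mathrm{Gal}(K/F)$ identified with $G$ by the choice of a generator $\sigma$, and let $L\supseteq K$ be a finite Galois extension of $F$ together with an identification $\mathrm{Gal}(L/F)=(A/A_j)\rtimes G$ under which the projection onto $G$ is the restriction map $\mathrm{Gal}(L/F)\to\mathrm{Gal}(K/F)$.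 The embedding problem $$1\to A_j/A_i\to B_{i,e}\to (A/A_j)\rtimes G=\mathrm{Gal}(L/F)\to 1$$ is called solvable if there are a finite Galois extension $\tilde L/F$ containing $L$ and an isomorphism $\mathrm{Gal}(\tilde L/F)\cong B_{i,e}$ under which the restriction map $\mathrm{Gal}(\tilde L/F)\to\mathrm{Gal}(L/F)$ becomes the given surjection. It is denoted $\mathcal{E}_{i,j}(L)$ if $e=0$ and $\mathcal{E}'_{i,j}(L)$ if $e\ne 0$ (one problem for each $e\neq 0$). Let $p\ge i>j\ge1$, let $K_0/F_0$ be a cyclic extension of degree $p$ of fields of characteristic not $p$ with $\mathrm{Gal}(K_0/F_0)$ generated by $\sigma_0$, and let $L_0\supseteq K_0$ be a finite Galois extension of $F_0$ with an identification $\mathrm{Gal}(L_0/F_0)=(A/A_j)\rtimes G$ as above. Let $\xi_p$ be a primitive $p$th root of unity and put $F=F_0(\xi_p)$, $K=K_0(\xi_p)$, $L=L_0(\xi_p)$. Then $L/F$ is Galois, $K/F$ is cyclic of degree $p$ with Galois group generated by the extension $\sigma$ of $\sigma_0$ that is trivial on $F$, and restriction to $L_0$ gives an isomorphism $\mathrm{Gal}(L/F)\cong\mathrm{Gal}(L_0/F_0)$,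 through which $\mathrm{Gal}(L/F)=(A/A_j)\rtimes G$, with projection onto $G$ the restriction to $K$. With these identifications: 1. $\mathcal{E}_{i,j}(L_0)$ is solvable if and only if $\mathcal{E}_{i,j}(L)$ is solvable; 2. for every $e\in\mathbb{F}_p$, $e\neq0$, $\mathcal{E}'_{i,j}(L_0)$ is solvable if and only if $\mathcal{E}'_{i,j}(L)$ is solvable, both with the group $B_{i,e}$. -/

import Mathlib

namespace CyclicEmbedding

section Groups

variable (p : ℕ)

/-- `A = ⊕ 𝔽_p τ^k` with `0 ≤ k < p` and `τ^p = 1`: the group algebra over `𝔽_p` of a cyclic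
group of order `p`, viewed as the free module of rank one over itself. The generator `σ` of the
cyclic group acts on `A` as multiplication by `τ`. -/
abbrev A : Type := MonoidAlgebra (ZMod p) (Multiplicative (ZMod p))

/-- The basis element `τ^k` of `A`, where `k` is an exponent modulo `p`. -/
noncomputable def tau (k : ZMod p) : A p :=
  MonoidAlgebra.of (ZMod p) (Multiplicative (ZMod p)) (Multiplicative.ofAdd k)

/-- The submodule `A_i` of `A` generated by `(τ - 1)^i`. -/
noncomputable def sub (i : ℕ) : Ideal (A p) := Ideal.span {(tau p 1 - 1) ^ i}

/-- The cyclic module `A / A_i`. -/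
abbrev Q (i : ℕ) : Type := A p ⧸ sub p i

/-- The image of `τ^k` in `A / A_i`; multiplication by it is the action of `σ^k`. -/
noncomputable def qtau (i : ℕ) (k : ZMod p) : Q p i := Ideal.Quotient.mk (sub p i) (tau p k)

/-- The class of `e (τ - 1)^(i - 1)` in `A / A_i`, for `e ∈ 𝔽_p`. -/
noncomputable def qtop (i : ℕ) (e : ZMod p) : Q p i :=
  Ideal.Quotient.mk (sub p i) (algebraMap (ZMod p) (A p) e * (tau p 1 - 1) ^ (i - 1))

theorem tau_zero : tau p 0 = 1 := by
  simp [tau, MonoidAlgebra.one_def]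

theorem tau_add (k l : ZMod p) : tau p (k + l) = tau p k * tau p l := by
  simp [tau, MonoidAlgebra.single_mul_single]

theorem qtau_zero (i : ℕ) : qtau p i 0 = 1 := by
  simp [qtau, tau_zero]

theorem qtau_add (i : ℕ) (k l : ZMod p) : qtau p i (k + l) = qtau p i k * qtau p i l := by
  simp [qtau, tau_add]

theorem qtop_zero (i : ℕ) : qtop p i 0 = 0 := by
  simp [qtop]

theorem qtop_add (i : ℕ) (c d : ZMod p) : qtop p i (c + d) = qtop p i c + qtop p i d := by
  simp only [qtop, map_add, add_mul]

/-- `σ` fixes `e (τ - 1)^(i - 1)` in `A / A_i`. -/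
theorem qtau_mul_qtop [NeZero p] (i : ℕ) (k c : ZMod p) :
    qtau p i k * qtop p i c = qtop p i c := by
  have h1 : qtau p i 1 * qtop p i c = qtop p i c := by
    rw [← sub_eq_zero, qtau, qtop, ← map_mul, ← map_sub, Ideal.Quotient.eq_zero_iff_mem, sub,
      Ideal.mem_span_singleton]
    have h2 : tau p 1 * (algebraMap (ZMod p) (A p) c * (tau p 1 - 1) ^ (i - 1))
        - algebraMap (ZMod p) (A p) c * (tau p 1 - 1) ^ (i - 1)
        = algebraMap (ZMod p) (A p) c * (tau p 1 - 1) ^ (i - 1 + 1) := by ring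
    rw [h2]
    exact Dvd.dvd.mul_left (pow_dvd_pow _ (by omega)) _
  have h3 : ∀ n : ℕ, qtau p i (n : ZMod p) * qtop p i c = qtop p i c := by
    intro n
    induction n with
    | zero => simp [qtau_zero]
    | succ n ih => rw [Nat.cast_succ, qtau_add, mul_assoc, h1, ih]
  have h4 := h3 k.val
  rwa [ZMod.natCast_zmod_val] at h4

theorem sub_le {i j : ℕ} (h : j ≤ i) : sub p i ≤ sub p j :=
  Ideal.span_singleton_le_span_singleton.mpr (pow_dvd_pow _ h)

/-- The projection `A / A_i → A / A_j` for `j ≤ i`. -/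
noncomputable def qmap {i j : ℕ} (h : j ≤ i) : Q p i →+* Q p j :=
  Ideal.Quotient.factor (sub_le p h)

theorem qmap_qtau {i j : ℕ} (h : j ≤ i) (k : ZMod p) :
    qmap p h (qtau p i k) = qtau p j k := by
  simp only [qmap, qtau, Ideal.Quotient.factor_mk]

theorem qmap_qtop {i j : ℕ} (h : j < i) (c : ZMod p) : qmap p h.le (qtop p i c) = 0 := by
  rw [qmap, qtop, Ideal.Quotient.factor_mk, Ideal.Quotient.eq_zero_iff_mem, sub,
    Ideal.mem_span_singleton]
  exact Dvd.dvd.mul_left (pow_dvd_pow _ (by omega)) _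

variable [Fact p.Prime]

/-- The carry when the representatives `0 ≤ k, l < p` of two residues are added. -/
def carry (k l : ZMod p) : ℕ := (k.val + l.val) / p

theorem carry_zero_left (k : ZMod p) : carry p 0 k = 0 := by
  simp [carry, Nat.div_eq_of_lt (ZMod.val_lt k)]

theorem carry_assoc (k l m : ZMod p) :
    carry p k l + carry p (k + l) m = carry p l m + carry p k (l + m) := by
  have hp : 0 < p := (Fact.out : p.Prime).pos
  have key : ∀ a b : ZMod p, p * carry p a b + (a + b).val = a.val + b.val := by
    intro a b
    rw [ZMod.val_add, carry]
    exact Nat.div_add_mod _ _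
  have e1 := key k l
  have e2 := key (k + l) m
  have e3 := key l m
  have e4 := key k (l + m)
  rw [add_assoc] at e2
  apply Nat.eq_of_mul_eq_mul_left hp
  rw [Nat.mul_add, Nat.mul_add]
  omega

/-- The group `B_{i,e}`: the extension of `A / A_i` by the cyclic group `G = ⟨σ⟩` of order `p`
in which `σ` acts on `A / A_i` as multiplication by `τ` and in which a lift of `σ` has `p`-th power
`e (τ - 1)^(i - 1)`. The pair `⟨a, k⟩` stands for `a * s ^ k` with `0 ≤ k < p`, where
`s = ⟨0, 1⟩` is that lift of `σ`. For `e = 0` this is the semidirect product `(A / A_i) ⋊ G`. -/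
@[ext]
structure B (i : ℕ) (e : ZMod p) : Type where
  /-- the component in `A / A_i` -/
  vec : Q p i
  /-- the exponent of `σ`, which is the image in `G` -/
  exp : ZMod p

variable {p} {i : ℕ} {e : ZMod p}

namespace B

noncomputable instance : Mul (B p i e) :=
  ⟨fun x y => ⟨x.vec + qtau p i x.exp * y.vec + qtop p i (e * carry p x.exp y.exp),
    x.exp + y.exp⟩⟩

noncomputable instance : One (B p i e) := ⟨⟨0, 0⟩⟩

noncomputable instance : Inv (B p i e) :=
  ⟨fun x => ⟨-(qtau p i (-x.exp) * x.vec)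
    - qtop p i (e * carry p (-x.exp) x.exp), -x.exp⟩⟩

theorem mul_vec (x y : B p i e) : (x * y).vec =
    x.vec + qtau p i x.exp * y.vec + qtop p i (e * carry p x.exp y.exp) := rfl

theorem mul_exp (x y : B p i e) : (x * y).exp = x.exp + y.exp := rfl

theorem one_vec : (1 : B p i e).vec = 0 := rfl

theorem one_exp : (1 : B p i e).exp = 0 := rfl

theorem inv_vec (x : B p i e) : x⁻¹.vec =
    -(qtau p i (-x.exp) * x.vec) - qtop p i (e * carry p (-x.exp) x.exp) := rfl

theorem inv_exp (x : B p i e) : x⁻¹.exp = -x.exp := rfl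

noncomputable instance : Group (B p i e) :=
  Group.ofLeftAxioms
    (by
      intro x y z
      ext1
      · simp only [mul_vec, mul_exp, qtau_add, mul_add, qtau_mul_qtop]
        have h := congrArg (fun n : ℕ => qtop p i (e * n))
          (carry_assoc p x.exp y.exp z.exp)
        simp only [Nat.cast_add, mul_add, qtop_add] at h
        linear_combination h
      · simp only [mul_exp, add_assoc])
    (by
      intro x
      ext1
      · simp [mul_vec, one_vec, one_exp, qtau_zero, qtop_zero, carry_zero_left]
      · simp [mul_exp, one_exp])
    (by
      intro x
      ext1
      · rw [mul_vec, one_vec, inv_vec, inv_exp]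
        ring
      · simp [mul_exp, one_exp, inv_exp])

/-- The surjection `B_{i,e} → B_{j,0} = (A / A_j) ⋊ G` for `j < i`, with kernel `A_j / A_i`, which is
the projection `A / A_i → A / A_j` on the first component and the identity on `G`. -/
noncomputable def proj {j : ℕ} (hji : j < i) (e : ZMod p) : B p i e →* B p j 0 where
  toFun x := ⟨qmap p hji.le x.vec, x.exp⟩
  map_one' := by
    ext1
    · simp [one_vec]
    · rfl
  map_mul' x y := by
    ext1
    · simp [mul_vec, qmap_qtop p hji, qmap_qtau, qtop_zero]
    · rfl

end B

end Groups

section Fields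

universe u v

variable {p : ℕ} [Fact p.Prime]

/-- The setting of the embedding problems: `L / F` is a finite Galois extension, `K / F` is a cyclic
subextension of degree `p` with Galois group generated by `σ`, and `φ` is an identification of
`Gal(L / F)` with `(A / A_j) ⋊ G`, `G = ⟨σ⟩`, under which the projection onto `G` is the
restriction of automorphisms to `K`. -/
structure IsIdentification {F : Type u} {L : Type v} [Field F] [Field L] [Algebra F L] {j : ℕ}
    (K : IntermediateField F L) (σ : K ≃ₐ[F] K) (φ : (L ≃ₐ[F] L) ≃* B p j 0) : Prop where
  finiteDimensional : FiniteDimensional F L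
  isGalois : IsGalois F L
  isGalois_mid : IsGalois F K
  finrank_mid : Module.finrank F K = p
  generator : ∀ g : K ≃ₐ[F] K, g ∈ Subgroup.zpowers σ
  restrict : ∀ (g : L ≃ₐ[F] L) (x : K), g (x : L) = ((σ ^ (φ g).exp.val) x : K)

/-- The embedding problem
`1 → A_j / A_i → B_{i,e} → (A / A_j) ⋊ G = Gal(L / F) → 1`, where the last identification is `φ`,
is solvable: there are a finite Galois extension `M / F` containing `L` and an isomorphism
`ψ : Gal(M / F) ≃ B_{i,e}` such that restriction `Gal(M / F) → Gal(L / F)` is identified by `ψ` and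
`φ` with the projection `B_{i,e} → (A / A_j) ⋊ G`. -/
def EmbeddingSolvable {F : Type u} {L : Type v} [Field F] [Field L] [Algebra F L] {i j : ℕ}
    (hji : j < i) (e : ZMod p) (φ : (L ≃ₐ[F] L) ≃* B p j 0) : Prop :=
  ∃ (M : Type v) (_ : Field M) (_ : Algebra F M) (_ : Algebra L M) (_ : IsScalarTower F L M)
    (_ : FiniteDimensional F M) (_ : IsGalois F M) (ψ : (M ≃ₐ[F] M) ≃* B p i e),
    ∀ (g : M ≃ₐ[F] M) (x : L),
      g (algebraMap L M x) = algebraMap L M (φ.symm (B.proj hji e (ψ g)) x)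

end Fields

end CyclicEmbedding

namespace CyclicEmbedding

/-! ### Group theory of the extensions `B p i e` -/

section GroupLemmas

variable {p : ℕ} [Fact p.Prime] {i j : ℕ} {e : ZMod p}

/-! The degree `[F : F₀]` is at most `p - 1`, hence prime to `p`, while every group `B p i e` is a
`p`-group. Counting degrees then shows that the injective restriction `Gal(L/F) → Gal(L₀/F₀)` is an
isomorphism, and this is the required `φ`.

Two facts about `B p i e` compare the embedding problems. The kernel of `B.proj` lies in the
Frattini subgroup, by Nakayama's lemma for the cyclic module `A / A_i` over the local ring `A`
(`B.eq_top_of_map_proj_eq_top`). So every lift of the restriction map to a homomorphism into `B p i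
e` is surjective, and the fixed field of its kernel solves the problem (`EmbeddingSolvable.of_hom`).
Thus solvability means that a lift exists.

Going up, a lift over `F₀` is restricted to the Galois group over `F`
(`EmbeddingSolvable.baseChange`). Going down, a lift over `F` is defined on a subgroup of index `[F
: F₀]`. Since that index is invertible on the `𝔽_p`-module `A / A_i`, averaging over cosets extends
the lift (`B.exists_lift_of_lift_subgroup`), as in the injectivity of restriction on `H²`. The value
of `e` plays no role. -/

theorem natCast_smul_Q (i : ℕ) (a : Q p i) : (p : Q p i) * a = 0 := by
  have h : ((p : A p)) = 0 := by
    rw [← map_natCast (algebraMap (ZMod p) (A p)) p, CharP.cast_eq_zero, map_zero]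
  rw [← map_natCast (Ideal.Quotient.mk (sub p i)) p, h, map_zero, zero_mul]

/-- The inclusion of `A / A_i` into `B_{i,e}`. -/
noncomputable def B.ofVec (i : ℕ) (e : ZMod p) : Multiplicative (Q p i) →* B p i e where
  toFun a := ⟨a.toAdd, 0⟩
  map_one' := rfl
  map_mul' a b := by
    ext1
    · simp [B.mul_vec, qtau_zero, carry_zero_left, qtop_zero]
    · simp [B.mul_exp]

theorem B.ofVec_apply (a : Q p i) : B.ofVec i e (Multiplicative.ofAdd a) = ⟨a, 0⟩ := rfl

/-- The projection of `B_{i,e}` onto the cyclic group of order `p`. -/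
def B.expHom (i : ℕ) (e : ZMod p) : B p i e →* Multiplicative (ZMod p) where
  toFun x := Multiplicative.ofAdd x.exp
  map_one' := rfl
  map_mul' _ _ := rfl

theorem B.pow_exp (x : B p i e) (n : ℕ) : (x ^ n).exp = n * x.exp := by
  have h := congrArg Multiplicative.toAdd (map_pow (B.expHom i e) x n)
  simpa [B.expHom] using h

/-- A `p`-th power has exponent zero, so it lies in `A / A_i`, which is killed by `p`; hence `x ^ p
^ 2 = 1`. -/
theorem B.isPGroup : IsPGroup p (B p i e) := by
  intro x
  refine ⟨2, ?_⟩
  have h1 : x ^ p = B.ofVec i e (Multiplicative.ofAdd (x ^ p).vec) := by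
    ext1
    · rfl
    · rw [B.ofVec_apply, B.pow_exp]; simp
  rw [pow_two, pow_mul, h1, ← map_pow, ← ofAdd_nsmul, nsmul_eq_mul, natCast_smul_Q]
  rfl

theorem B.proj_exp (hji : j < i) (x : B p i e) : (B.proj hji e x).exp = x.exp := rfl

theorem B.proj_vec (hji : j < i) (x : B p i e) :
    (B.proj hji e x).vec = qmap p hji.le x.vec := rfl

theorem B.proj_surjective (hji : j < i) : Function.Surjective (B.proj hji e) := by
  intro y
  obtain ⟨a, ha⟩ := Ideal.Quotient.factor_surjective (sub_le p hji.le) y.vec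
  exact ⟨⟨a, y.exp⟩, B.ext ha rfl⟩

/-- In characteristic `p`, `(τ - 1)^p = τ^p - 1 = 0`. This is what makes `A` local. -/
theorem isNilpotent_tau_sub_one : IsNilpotent (tau p 1 - 1) := by
  have : CharP (A p) p := charP_of_injective_algebraMap
    (FaithfulSMul.algebraMap_injective (ZMod p) (A p)) p
  refine ⟨p, ?_⟩
  rw [sub_pow_char, one_pow, tau, ← map_pow, ← ofAdd_nsmul]
  simp [MonoidAlgebra.one_def]

/-- A representative differs from `1` by a multiple of `(τ - 1)^j`, which is nilpotent because `j ≥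
1`. -/
theorem isUnit_of_qmap_eq_one (hj : 1 ≤ j) (hji : j < i) {a : Q p i}
    (ha : qmap p hji.le a = 1) : IsUnit a := by
  obtain ⟨a, rfl⟩ := Ideal.Quotient.mk_surjective a
  rw [qmap, Ideal.Quotient.factor_mk, ← map_one (Ideal.Quotient.mk (sub p j)),
    Ideal.Quotient.eq, sub, Ideal.mem_span_singleton] at ha
  obtain ⟨c, hc⟩ := ha
  have h1 : IsNilpotent (a - 1) := by
    rw [hc]
    exact (Commute.all _ _).isNilpotent_mul_right (isNilpotent_tau_sub_one.pow_of_pos (by omega))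
  have h2 : IsUnit a := by
    simpa using h1.isUnit_one_add
  exact h2.map _

theorem B.conj_ofVec (x : B p i e) (a : Q p i) :
    x * ⟨a, 0⟩ * x⁻¹ = ⟨qtau p i x.exp * a, 0⟩ := by
  rw [mul_inv_eq_iff_eq_mul]
  ext1
  · simp only [B.mul_vec, qtau_zero, carry_zero_left, one_mul]
    simp [carry, Nat.div_eq_of_lt (ZMod.val_lt x.exp), qtop_zero]
    ring
  · simp [B.mul_exp]

/-- The kernel of `B_{i,e} → (A / A_j) ⋊ G` is contained in the Frattini subgroup. -/
theorem B.eq_top_of_map_proj_eq_top (hj : 1 ≤ j) (hji : j < i) (H : Subgroup (B p i e))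
    (hH : ∀ y, ∃ x ∈ H, B.proj hji e x = y) : H = ⊤ := by
  -- A lift of the generator `1` of `A / A_j` is a unit of `A / A_i`, so it generates `A / A_i` as a
  -- module.
  obtain ⟨u, huH, hu⟩ := hH ⟨1, 0⟩
  have hu0 : u.exp = 0 := by rw [← B.proj_exp hji, hu]
  have hunit : IsUnit u.vec := isUnit_of_qmap_eq_one hj hji (by rw [← B.proj_vec hji, hu])
  have huvec : (⟨u.vec, 0⟩ : B p i e) ∈ H := by
    convert huH using 1
    exact B.ext rfl hu0.symm
  have hadd : ∀ a b : Q p i, (⟨a, 0⟩ : B p i e) ∈ H → (⟨b, 0⟩ : B p i e) ∈ H →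
      (⟨a + b, 0⟩ : B p i e) ∈ H := fun a b ha hb => by
    have h := map_mul (B.ofVec i e) (Multiplicative.ofAdd a) (Multiplicative.ofAdd b)
    rw [← ofAdd_add] at h
    simp only [B.ofVec_apply] at h
    rw [h]
    exact mul_mem ha hb
  have hnsmul : ∀ (n : ℕ) (a : Q p i), (⟨a, 0⟩ : B p i e) ∈ H → (⟨n * a, 0⟩ : B p i e) ∈ H :=
      fun n a ha => by
    have h := map_pow (B.ofVec i e) (Multiplicative.ofAdd a) n
    rw [← ofAdd_nsmul, nsmul_eq_mul] at h
    simp only [B.ofVec_apply] at h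
    rw [h]
    exact pow_mem ha n
  -- `H` meets `A / A_i` in an `A`-submodule: `τ^k` acts as conjugation by an element of `H` of
  -- exponent `k`, and scalars of `𝔽_p` act as natural multiples.
  have hmul : ∀ c : A p, (⟨Ideal.Quotient.mk (sub p i) c * u.vec, 0⟩ : B p i e) ∈ H := by
    intro c
    induction c using MonoidAlgebra.induction_on with
    | of k =>
      obtain ⟨x, hxH, hx⟩ := hH ⟨0, k.toAdd⟩
      have hk : x.exp = k.toAdd := by rw [← B.proj_exp hji, hx]
      have h := mul_mem (mul_mem hxH huvec) (inv_mem hxH)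
      rwa [B.conj_ofVec, hk] at h
    | add a b ha hb =>
      rw [map_add, add_mul]
      exact hadd _ _ ha hb
    | smul r a ha =>
      have h := hnsmul r.val _ ha
      have hr : r • a = (r.val : A p) * a := by
        rw [Algebra.smul_def, ← map_natCast (algebraMap (ZMod p) (A p)) r.val,
          ZMod.natCast_zmod_val]
      rwa [hr, map_mul, map_natCast, mul_assoc]
  have hvec : ∀ a : Q p i, (⟨a, 0⟩ : B p i e) ∈ H := by
    intro a
    obtain ⟨v, hv⟩ := hunit.exists_left_inv
    obtain ⟨c, hc⟩ := Ideal.Quotient.mk_surjective (a * v)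
    have h := hmul c
    rwa [hc, mul_assoc, hv, mul_one] at h
  rw [eq_top_iff]
  intro y _
  obtain ⟨x, hxH, hx⟩ := hH (B.proj hji e y)
  have h0 : (y * x⁻¹).exp = 0 := by
    rw [← B.proj_exp hji, map_mul, map_inv, hx, mul_inv_cancel, B.one_exp]
  have h1 : y * x⁻¹ ∈ H := by
    convert hvec (y * x⁻¹).vec using 1
    exact B.ext rfl h0
  simpa using mul_mem h1 hxH

/-- A lift to `B_{i,e}` of a homomorphism to `(A / A_j) ⋊ G` that exists on a subgroup of index
prime to `p` exists on the whole group: average its translates over the cosets. -/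
theorem B.exists_lift_of_lift_subgroup (hji : j < i) {Γ : Type*} [Group Γ] (H : Subgroup Γ)
    [H.FiniteIndex] (hH : H.index.Coprime p) (π : Γ →* B p j 0) (ψ : H →* B p i e)
    (hψ : ∀ h : H, B.proj hji e (ψ h) = π h) :
    ∃ Ψ : Γ →* B p i e, ∀ g, B.proj hji e (Ψ g) = π g := by
  classical
  let : Fintype (Γ ⧸ H) := H.fintypeQuotientOfFiniteIndex
  let t : Γ ⧸ H → Γ := Quotient.out
  have ht : ∀ x, (t x : Γ ⧸ H) = x := fun x => Quotient.out_eq' x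
  choose b hb using fun x : Γ ⧸ H => B.proj_surjective (e := e) hji (π (t x))
  have hmem : ∀ g x, (t (g • x))⁻¹ * (g * t x) ∈ H := fun g x => by
    rw [← QuotientGroup.eq, ht, ← smul_eq_mul, ← MulAction.Quotient.smul_coe, ht]
  -- For each coset `x`, this is a candidate lift of `π g`: `ψ` is applied to the `H`-part of `g * t
  -- x`, and the coset representatives are replaced by arbitrary lifts `b` of their images. It
  -- satisfies the twisted rule `hℓmul`.
  let ℓ : Γ → Γ ⧸ H → B p i e := fun g x =>
    b (g • x) * ψ ⟨(t (g • x))⁻¹ * (g * t x), hmem g x⟩ * (b x)⁻¹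
  have hℓ : ∀ g x, B.proj hji e (ℓ g x) = π g := fun g x => by
    simp only [ℓ, map_mul, map_inv, hb, hψ]
    group
  have hℓmul : ∀ g g' x, ℓ (g * g') x = ℓ g (g' • x) * ℓ g' x := fun g g' x => by
    have h1 : ψ ⟨(t ((g * g') • x))⁻¹ * (g * g' * t x), hmem (g * g') x⟩
        = ψ ⟨(t (g • g' • x))⁻¹ * (g * t (g' • x)), hmem g (g' • x)⟩
          * ψ ⟨(t (g' • x))⁻¹ * (g' * t x), hmem g' x⟩ := by
      rw [← map_mul]
      congr 1
      ext1
      simp only [mul_smul, Subgroup.coe_mul]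
      group
    simp only [ℓ]
    rw [h1, mul_smul]
    simp only [mul_assoc, inv_mul_cancel_left]
  have hexp : ∀ g x, (ℓ g x).exp = (π g).exp := fun g x => by rw [← hℓ g x, B.proj_exp]
  let m : ZMod p := (H.index : ZMod p)⁻¹
  have hm : m * H.index = 1 := by
    rw [mul_comm]
    exact ZMod.coe_mul_inv_eq_one _ hH
  have hmQ : ∀ k, (algebraMap (ZMod p) (Q p k) m) * (H.index : Q p k) = 1 := fun k => by
    rw [← map_natCast (algebraMap (ZMod p) (Q p k)) H.index, ← map_mul, hm, map_one]
  have hsum : ∀ k (c : Q p k), algebraMap (ZMod p) (Q p k) m * ∑ _x : Γ ⧸ H, c = c := fun k c => by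
    rw [Finset.sum_const, Finset.card_univ, ← Nat.card_eq_fintype_card, ← Subgroup.index,
      nsmul_eq_mul, ← mul_assoc, hmQ, one_mul]
  -- All `ℓ g x` have the exponent of `π g`, so the product of two of them is affine in the vector
  -- components, with twist and carry independent of `x`. Averaging the vectors therefore turns the
  -- twisted rule into multiplicativity.
  refine ⟨MonoidHom.mk' (fun g => ⟨algebraMap (ZMod p) (Q p i) m * ∑ x, (ℓ g x).vec,
    (π g).exp⟩) ?_, ?_⟩
  · intro g g'
    ext1
    · have h1 : ∑ x, (ℓ (g * g') x).vec = ∑ x, (ℓ g x).vec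
          + qtau p i (π g).exp * ∑ x, (ℓ g' x).vec
          + ∑ _x : Γ ⧸ H, qtop p i (e * carry p (π g).exp (π g').exp) := by
        simp only [hℓmul, B.mul_vec, hexp, Finset.sum_add_distrib, Finset.mul_sum]
        -- Left translation by `g'` permutes the cosets, which removes the twist from the sum.
        congr 2
        exact Fintype.sum_equiv (MulAction.toPerm g') _ _ fun x => rfl
      simp only [h1, B.mul_vec, mul_add, hsum]
      ring
    · simp [B.mul_exp]
  · intro g
    ext1
    · have h1 : ∀ x, qmap p hji.le (ℓ g x).vec = (π g).vec := fun x => by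
        rw [← B.proj_vec hji, hℓ]
      have h2 : qmap p hji.le (algebraMap (ZMod p) (Q p i) m)
          = algebraMap (ZMod p) (Q p j) m := rfl
      simp only [B.proj_vec, MonoidHom.mk'_apply, map_mul, map_sum, h1, h2, hsum]
    · rfl

end GroupLemmas

end CyclicEmbedding
namespace CyclicEmbedding

/-! ### Embedding problems as lifting problems, and change of base field -/

section FieldLemmas

universe u v w

variable {p : ℕ} [Fact p.Prime] {i j : ℕ} {e : ZMod p}

/-- A homomorphism to `B_{i,e}` from the Galois group of any finite Galois extension containing `L`
which lifts the restriction to `L` yields a solution of the embedding problem. -/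
theorem EmbeddingSolvable.of_hom {F : Type u} {L N : Type v} [Field F] [Field L] [Field N]
    [Algebra F L] [Algebra F N] [Algebra L N] [IsScalarTower F L N] [FiniteDimensional F N]
    [IsGalois F N] [IsGalois F L] (hj : 1 ≤ j) (hji : j < i) (φ : (L ≃ₐ[F] L) ≃* B p j 0)
    (Ψ : (N ≃ₐ[F] N) →* B p i e)
    (hΨ : ∀ (g : N ≃ₐ[F] N) (x : L),
      g (algebraMap L N x) = algebraMap L N (φ.symm (B.proj hji e (Ψ g)) x)) :
    EmbeddingSolvable hji e φ := by
  -- The range of `Ψ` maps onto `(A / A_j) ⋊ G` because restriction to `L` is surjective; the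
  -- Frattini property does the rest.
  have hsurj : Function.Surjective Ψ := by
    rw [← MonoidHom.range_eq_top]
    refine B.eq_top_of_map_proj_eq_top hj hji _ fun y => ?_
    obtain ⟨g, hg⟩ := AlgEquiv.restrictNormalHom_surjective (K₁ := L) N (φ.symm y)
    refine ⟨Ψ g, ⟨g, rfl⟩, ?_⟩
    apply φ.symm.injective
    rw [← hg]
    ext x
    apply (algebraMap L N).injective
    rw [← hΨ, AlgEquiv.restrictNormalHom, MonoidHom.mk'_apply, AlgEquiv.restrictNormal_commutes]
  let M : IntermediateField F N := IntermediateField.fixedField Ψ.ker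
  have hLM : ∀ x, algebraMap L N x ∈ M := fun x => by
    rw [IntermediateField.mem_fixedField_iff]
    intro g hg
    rw [MonoidHom.mem_ker] at hg
    rw [hΨ, hg, map_one, map_one, AlgEquiv.one_apply]
  let _ : Algebra L M := ((algebraMap L N).codRestrict M hLM).toAlgebra
  have : IsScalarTower F L M := IsScalarTower.of_algebraMap_eq fun x => Subtype.ext <| by
    change algebraMap F N x = algebraMap L N (algebraMap F L x)
    exact IsScalarTower.algebraMap_apply F L N x
  let θ : (N ≃ₐ[F] N) ⧸ Ψ.ker ≃* (M ≃ₐ[F] M) := IsGalois.normalAutEquivQuotient Ψ.ker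
  refine ⟨M, inferInstance, inferInstance, inferInstance, inferInstance, inferInstance,
    inferInstance, θ.symm.trans (QuotientGroup.quotientKerEquivOfSurjective Ψ hsurj), ?_⟩
  intro g x
  obtain ⟨q, rfl⟩ := θ.surjective g
  obtain ⟨g, rfl⟩ := QuotientGroup.mk_surjective q
  rw [MulEquiv.trans_apply, MulEquiv.symm_apply_apply]
  apply Subtype.ext
  change algebraMap M N (AlgEquiv.restrictNormal g M _)
    = algebraMap L N (φ.symm (B.proj hji e (Ψ g)) x)
  rw [← hΨ, AlgEquiv.restrictNormal_commutes]
  rfl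

/-- Two finite separable extensions of `k` containing `l` have a common finite Galois extension,
which may be taken in the universe of the first one. -/
theorem exists_common_galois_extension {k : Type*} {l : Type*} {X : Type v} {Y : Type*} [Field k]
    [Field l] [Field X] [Field Y] [Algebra k l] [Algebra k X] [Algebra k Y] [Algebra l X]
    [Algebra l Y] [IsScalarTower k l X] [IsScalarTower k l Y] [FiniteDimensional k X]
    [FiniteDimensional k Y] [Algebra.IsSeparable k X] [Algebra.IsSeparable k Y] :
    ∃ (N : Type v) (_ : Field N) (_ : Algebra k N) (_ : Algebra X N) (_ : IsScalarTower k X N)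
      (_ : FiniteDimensional k N) (_ : IsGalois k N) (f : Y →ₐ[k] N),
      ∀ x : l, f (algebraMap l Y x) = algebraMap X N (algebraMap l X x) := by
  let Ω := SeparableClosure X
  let _ : Algebra l Ω := ((algebraMap X Ω).comp (algebraMap l X)).toAlgebra
  let _ : Algebra k Ω := ((algebraMap X Ω).comp (algebraMap k X)).toAlgebra
  have : IsScalarTower k X Ω := IsScalarTower.of_algebraMap_eq fun _ => rfl
  have : IsScalarTower l X Ω := IsScalarTower.of_algebraMap_eq fun _ => rfl
  have : IsScalarTower k l Ω := IsScalarTower.of_algebraMap_eq fun x => by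
    change algebraMap X Ω (algebraMap k X x) = algebraMap X Ω (algebraMap l X (algebraMap k l x))
    rw [← IsScalarTower.algebraMap_apply k l X]
  have : Algebra.IsSeparable k Ω := Algebra.IsSeparable.trans k X Ω
  have : IsSepClosure k Ω := ⟨inferInstance, inferInstance⟩
  have : Algebra.IsSeparable l Y := Algebra.isSeparable_tower_top_of_isSeparable k l Y
  -- Embedding `Y` over `l`, not merely over `k`, makes the two copies of `l` coincide.
  let f : Y →ₐ[l] Ω := IsSepClosed.lift
  let f' : Y →ₐ[k] Ω := f.restrictScalars k
  let N : IntermediateField k Ω :=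
    IntermediateField.normalClosure k X Ω ⊔ IntermediateField.normalClosure k Y Ω
  have hX : ∀ x : X, algebraMap X Ω x ∈ N := fun x =>
    (le_sup_left : _ ≤ N) ((IsScalarTower.toAlgHom k X Ω).fieldRange_le_normalClosure ⟨x, rfl⟩)
  have hY : ∀ y : Y, f' y ∈ N := fun y =>
    (le_sup_right : _ ≤ N) (f'.fieldRange_le_normalClosure ⟨y, rfl⟩)
  let _ : Algebra X N := ((algebraMap X Ω).codRestrict N hX).toAlgebra
  have hN : IsGalois k N := { to_isSeparable := inferInstance, to_normal := inferInstance }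
  refine ⟨N, inferInstance, inferInstance, inferInstance,
    IsScalarTower.of_algebraMap_eq fun _ => rfl, inferInstance, hN,
    f'.codRestrict N.toSubalgebra hY, fun x => Subtype.ext ?_⟩
  exact f.commutes x

section BaseChange

variable {F₀ : Type u} {F : Type*} {L₀ : Type v} {L : Type w} [Field F₀] [Field F] [Field L₀]
  [Field L] [Algebra F₀ F] [Algebra F₀ L₀] [Algebra F₀ L] [Algebra F L] [Algebra L₀ L]
  [IsScalarTower F₀ F L] [IsScalarTower F₀ L₀ L]
  [FiniteDimensional F₀ L] [Algebra.IsSeparable F₀ L]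
  {φ₀ : (L₀ ≃ₐ[F₀] L₀) ≃* B p j 0} {φ : (L ≃ₐ[F] L) ≃* B p j 0}

/-- A solution of the embedding problem over `F₀` yields one over an extension `F` by composition
with `L`. -/
theorem EmbeddingSolvable.baseChange [IsGalois F L] (hj : 1 ≤ j) (hji : j < i)
    (hφ : ∀ (g : L ≃ₐ[F] L) (x : L₀),
      g (algebraMap L₀ L x) = algebraMap L₀ L (φ₀.symm (φ g) x))
    (h : EmbeddingSolvable hji e φ₀) : EmbeddingSolvable hji e φ := by
  obtain ⟨M, _, _, _, _, _, _, ψ, hψ⟩ := h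
  obtain ⟨N, _, _, _, _, _, _, f, hf⟩ :=
    exists_common_galois_extension (k := F₀) (l := L₀) (X := L) (Y := M)
  let _ : Algebra F N := ((algebraMap L N).comp (algebraMap F L)).toAlgebra
  have : IsScalarTower F L N := IsScalarTower.of_algebraMap_eq fun _ => rfl
  have : IsScalarTower F₀ F N := IsScalarTower.of_algebraMap_eq fun x => by
    change _ = algebraMap L N (algebraMap F L (algebraMap F₀ F x))
    rw [← IsScalarTower.algebraMap_apply F₀ F L, ← IsScalarTower.algebraMap_apply F₀ L N]
  have : IsGalois F N := IsGalois.tower_top_of_isGalois F₀ F N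
  have : FiniteDimensional F N := FiniteDimensional.right F₀ F N
  let _ : Algebra M N := f.toRingHom.toAlgebra
  have : IsScalarTower F₀ M N := IsScalarTower.of_algebraMap_eq fun x => (f.commutes x).symm
  let r : (N ≃ₐ[F] N) →* (M ≃ₐ[F₀] M) :=
    (AlgEquiv.restrictNormalHom M).comp (AlgEquiv.restrictScalarsHom F₀)
  have hr : ∀ g x, g (f x) = f (r g x) := fun g x =>
    ((g.restrictScalars F₀).restrictNormal_commutes M x).symm
  refine EmbeddingSolvable.of_hom hj hji φ (ψ.toMonoidHom.comp r) fun g x => ?_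
  -- Both sides describe the action of `g` on `L₀`, seen through `L` and through `M`; `φ₀` is
  -- injective.
  have hg : φ (AlgEquiv.restrictNormalHom L g) = B.proj hji e (ψ (r g)) := by
    apply φ₀.symm.injective
    ext y
    apply (algebraMap L₀ L).injective
    apply (algebraMap L N).injective
    rw [← hφ, AlgEquiv.restrictNormalHom, MonoidHom.mk'_apply, AlgEquiv.restrictNormal_commutes,
      ← hf, hr, hψ, hf]
  change _ = algebraMap L N (φ.symm (B.proj hji e (ψ (r g))) x)
  rw [← hg, MulEquiv.symm_apply_apply, AlgEquiv.restrictNormalHom, MonoidHom.mk'_apply,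
    AlgEquiv.restrictNormal_commutes]

/-- A solution of the embedding problem over an extension `F / F₀` of degree prime to `p` yields
one over `F₀`. -/
theorem EmbeddingSolvable.descend [IsGalois F₀ L₀] (hj : 1 ≤ j) (hji : j < i)
    (hφ : ∀ (g : L ≃ₐ[F] L) (x : L₀),
      g (algebraMap L₀ L x) = algebraMap L₀ L (φ₀.symm (φ g) x))
    (hF : (Module.finrank F₀ F).Coprime p)
    (h : EmbeddingSolvable hji e φ) : EmbeddingSolvable hji e φ₀ := by
  obtain ⟨M, _, _, _, _, _, _, ψ, hψ⟩ := h
  let _ : Algebra F₀ M := ((algebraMap F M).comp (algebraMap F₀ F)).toAlgebra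
  let _ : Algebra L₀ M := ((algebraMap L M).comp (algebraMap L₀ L)).toAlgebra
  have : IsScalarTower F₀ F M := IsScalarTower.of_algebraMap_eq fun _ => rfl
  have : IsScalarTower L₀ L M := IsScalarTower.of_algebraMap_eq fun _ => rfl
  have : IsScalarTower F₀ L₀ M := IsScalarTower.of_algebraMap_eq fun x => by
    rw [IsScalarTower.algebraMap_apply L₀ L M, ← IsScalarTower.algebraMap_apply F₀ L₀ L,
      IsScalarTower.algebraMap_apply F₀ F M, IsScalarTower.algebraMap_apply F₀ F L,
      ← IsScalarTower.algebraMap_apply F L M]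
  have : FiniteDimensional F₀ F := FiniteDimensional.left F₀ F L
  have : FiniteDimensional F₀ M := FiniteDimensional.trans F₀ F M
  have : FiniteDimensional F₀ L₀ := FiniteDimensional.left F₀ L₀ L
  have : Algebra.IsSeparable F₀ F := Algebra.isSeparable_tower_bot_of_isSeparable F₀ F L
  have : Algebra.IsSeparable F₀ M := Algebra.IsSeparable.trans F₀ F M
  -- Taking `X = L₀` puts `N` in the universe of `L₀`, where a solution over `F₀` must live,
  -- although `M` lies in that of `L`.
  obtain ⟨N, _, _, _, _, _, _, f, hf⟩ :=
    exists_common_galois_extension (k := F₀) (l := L₀) (X := L₀) (Y := M)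
  let _ : Algebra M N := f.toRingHom.toAlgebra
  have : IsScalarTower F₀ M N := IsScalarTower.of_algebraMap_eq fun x => (f.commutes x).symm
  let _ : Algebra F N := ((algebraMap M N).comp (algebraMap F M)).toAlgebra
  have : IsScalarTower F M N := IsScalarTower.of_algebraMap_eq fun _ => rfl
  have : IsScalarTower F₀ F N := IsScalarTower.of_algebraMap_eq fun x => by
    rw [IsScalarTower.algebraMap_apply F M N, ← IsScalarTower.algebraMap_apply F₀ F M,
      ← IsScalarTower.algebraMap_apply F₀ M N]
  have : IsGalois F N := IsGalois.tower_top_of_isGalois F₀ F N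
  have : FiniteDimensional F N := FiniteDimensional.right F₀ F N
  let ι : (N ≃ₐ[F] N) →* (N ≃ₐ[F₀] N) := AlgEquiv.restrictScalarsHom F₀
  have hι : Function.Injective ι := AlgEquiv.restrictScalarsHom_injective F₀
  let ε : (N ≃ₐ[F] N) ≃* ι.range := MonoidHom.ofInjective hι
  have hindex : ι.range.index = Module.finrank F₀ F := by
    have h1 := ι.range.card_mul_index
    rw [← Nat.card_congr ε.toEquiv, IsGalois.card_aut_eq_finrank, IsGalois.card_aut_eq_finrank,
      ← Module.finrank_mul_finrank F₀ F N, mul_comm] at h1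
    exact Nat.eq_of_mul_eq_mul_right Module.finrank_pos h1
  let r : (N ≃ₐ[F] N) →* (M ≃ₐ[F] M) := AlgEquiv.restrictNormalHom M
  have hr : ∀ g x, g (f x) = f (r g x) := fun g x => (g.restrictNormal_commutes M x).symm
  let π : (N ≃ₐ[F₀] N) →* B p j 0 := φ₀.toMonoidHom.comp (AlgEquiv.restrictNormalHom L₀)
  have hπ : ∀ g x, g (algebraMap L₀ N x) = algebraMap L₀ N (φ₀.symm (π g) x) := fun g x => by
    change _ = algebraMap L₀ N (φ₀.symm (φ₀ (AlgEquiv.restrictNormalHom L₀ g)) x)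
    rw [MulEquiv.symm_apply_apply]
    exact (g.restrictNormal_commutes L₀ x).symm
  obtain ⟨Ψ, hΨ⟩ := B.exists_lift_of_lift_subgroup (e := e) hji ι.range (by rwa [hindex]) π
    (ψ.toMonoidHom.comp (r.comp ε.symm.toMonoidHom)) (by
      intro h
      obtain ⟨g, rfl⟩ := ε.surjective h
      change B.proj hji e (ψ (r (ε.symm (ε g)))) = π (ι g)
      rw [MulEquiv.symm_apply_apply]
      apply φ₀.symm.injective
      ext x
      apply (algebraMap L₀ N).injective
      rw [← hπ]
      have h1 := hφ (φ.symm (B.proj hji e (ψ (r g)))) x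
      rw [MulEquiv.apply_symm_apply] at h1
      have h2 : ∀ y, algebraMap L₀ N y = f (algebraMap L M (algebraMap L₀ L y)) := fun y =>
        (hf y).symm
      change _ = g (algebraMap L₀ N x)
      rw [h2, h2, hr, hψ, h1])
  exact EmbeddingSolvable.of_hom hj hji φ₀ Ψ fun g x => by rw [hΨ, hπ]

end BaseChange

end FieldLemmas

end CyclicEmbedding
namespace CyclicEmbedding

/-! ### Adjoining a root of unity -/

section RootsOfUnity

theorem isGalois_adjoin_primitiveRoot {k E : Type*} [Field k] [Field E] [Algebra k E] {n : ℕ}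
    [NeZero n] {ξ : E} (hξ : IsPrimitiveRoot ξ n) : IsGalois k (IntermediateField.adjoin k {ξ}) := by
  have : IsCyclotomicExtension {n} k (IntermediateField.adjoin k {ξ}) := by
    change IsCyclotomicExtension {n} k (IntermediateField.adjoin k {ξ}).toSubalgebra
    rw [IntermediateField.adjoin_simple_toSubalgebra_of_isAlgebraic
      (hξ.isIntegral (NeZero.pos n)).tower_top.isAlgebraic]
    exact hξ.adjoin_isCyclotomicExtension k
  exact IsCyclotomicExtension.isGalois {n} k _

/-- The minimal polynomial of `ξ` divides the `p`-th cyclotomic polynomial, so the degree is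
positive and at most `p - 1`. -/
theorem coprime_finrank_adjoin_primitiveRoot {k E : Type*} [Field k] [Field E] [Algebra k E]
    {p : ℕ} [hp : Fact p.Prime] {ξ : E} (hξ : IsPrimitiveRoot ξ p) :
    (Module.finrank k (IntermediateField.adjoin k {ξ})).Coprime p := by
  have hint : IsIntegral k ξ := hξ.isIntegral hp.out.pos |>.tower_top
  rw [IntermediateField.adjoin.finrank hint]
  have hdvd : minpoly k ξ ∣ Polynomial.cyclotomic p k := by
    refine minpoly.dvd k ξ ?_
    have := hξ.isRoot_cyclotomic hp.out.pos
    rwa [Polynomial.aeval_def, ← Polynomial.eval_map, Polynomial.map_cyclotomic]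
  have hle := Polynomial.natDegree_le_of_dvd hdvd (Polynomial.cyclotomic_ne_zero p k)
  rw [Polynomial.natDegree_cyclotomic, Nat.totient_prime hp.out] at hle
  have hpos := minpoly.natDegree_pos hint
  have := hp.out.two_le
  exact (Nat.coprime_of_lt_prime hpos.ne' (by omega) hp.out).symm

end RootsOfUnity

/-! ### Recognising the cyclic subextension from the exponent map -/

section Identification

variable {p : ℕ} [Fact p.Prime] {j : ℕ}

/-- If the image of `exp ∘ φ` in the cyclic group describes which automorphisms fix `K`, then some
generator of `Gal(K / F)` makes `φ` an identification. -/
theorem IsIdentification.of_fixes_iff {F L : Type*} [Field F] [Field L] [Algebra F L]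
    [FiniteDimensional F L] [IsGalois F L] (K : IntermediateField F L)
    (φ : (L ≃ₐ[F] L) ≃* B p j 0)
    (hK : ∀ g : L ≃ₐ[F] L, g ∈ K.fixingSubgroup ↔ (φ g).exp = 0) :
    ∃ σ : K ≃ₐ[F] K, IsIdentification K σ φ ∧ ∀ x : K, (σ x : L) = φ.symm ⟨0, 1⟩ (x : L) := by
  let ρ : (L ≃ₐ[F] L) →* Multiplicative (ZMod p) := (B.expHom j 0).comp φ.toMonoidHom
  have hρ : Function.Surjective ρ := fun k =>
    ⟨φ.symm ⟨0, k.toAdd⟩, by simp [ρ, B.expHom]⟩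
  have hker : K.fixingSubgroup = ρ.ker := by
    ext g
    rw [hK, MonoidHom.mem_ker]
    rfl
  have hGal : IsGalois F K := by
    rw [← InfiniteGalois.normal_iff_isGalois, hker]
    infer_instance
  let s : L ≃ₐ[F] L := φ.symm ⟨0, 1⟩
  let r : (L ≃ₐ[F] L) →* (K ≃ₐ[F] K) := AlgEquiv.restrictNormalHom K
  have hr : ∀ (g : L ≃ₐ[F] L) (x : K), (r g x : L) = g x :=
    fun g x => g.restrictNormal_commutes K x
  have hpow : ∀ g : L ≃ₐ[F] L, r g = r s ^ (φ g).exp.val := fun g => by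
    rw [← map_pow]
    -- `s` has exponent `1`, so `g` and this power of `s` have equal exponents and agree on `K`.
    have h1 : (s ^ (φ g).exp.val)⁻¹ * g ∈ K.fixingSubgroup := by
      rw [hK, map_mul, map_inv, map_pow, B.mul_exp, B.inv_exp, B.pow_exp]
      simp [s]
    ext x
    rw [hr, hr]
    have h2 := (IntermediateField.mem_fixingSubgroup_iff _ _).1 h1 x x.2
    rw [AlgEquiv.mul_apply, AlgEquiv.aut_inv, AlgEquiv.symm_apply_eq] at h2
    exact h2
  refine ⟨r s, ⟨inferInstance, inferInstance, hGal, ?_, ?_, ?_⟩, hr s⟩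
  · rw [IntermediateField.finrank_eq_fixingSubgroup_index L K, hker, Subgroup.index_ker,
      MonoidHom.range_eq_top.2 hρ, Nat.card_congr Subgroup.topEquiv.toEquiv]
    simp
  · intro g
    obtain ⟨g, rfl⟩ := AlgEquiv.restrictNormalHom_surjective L g
    exact ⟨_, (zpow_natCast _ _).trans (hpow g).symm⟩
  · intro g x
    rw [← hpow, hr]

/-- The exponent of `φ g` vanishes exactly for the automorphisms `g` fixing `K`. -/
theorem IsIdentification.exp_eq_zero_iff {F L : Type*} [Field F] [Field L] [Algebra F L]
    {K : IntermediateField F L} {σ : K ≃ₐ[F] K} {φ : (L ≃ₐ[F] L) ≃* B p j 0}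
    (h : IsIdentification K σ φ) (g : L ≃ₐ[F] L) :
    (φ g).exp = 0 ↔ ∀ x : K, g (x : L) = x := by
  have := h.finiteDimensional
  have := h.isGalois_mid
  have hord : orderOf σ = p := by
    rw [orderOf_eq_card_of_forall_mem_zpowers h.generator, IsGalois.card_aut_eq_finrank,
      h.finrank_mid]
  constructor
  · intro h0 x
    rw [h.restrict, h0]
    simp
  · intro hx
    have h1 : σ ^ (φ g).exp.val = 1 := by
      ext x
      rw [← h.restrict, hx, AlgEquiv.one_apply]
    rw [← orderOf_dvd_iff_pow_eq_one, hord] at h1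
    rw [← ZMod.val_eq_zero]
    exact Nat.eq_zero_of_dvd_of_lt h1 (ZMod.val_lt _)

end Identification

end CyclicEmbedding

/-! ### The theorem -/

open CyclicEmbedding in
theorem proposition4 {p : ℕ} [Fact p.Prime] (hp : 2 < p) {i j : ℕ} (hj : 1 ≤ j) (hji : j < i)
    (hi : i ≤ p) {F₀ L₀ L : Type*} [Field F₀] [Field L₀] [Field L] [Algebra F₀ L₀] [Algebra F₀ L]
    [Algebra L₀ L] [IsScalarTower F₀ L₀ L] (hchar : ringChar F₀ ≠ p)
    (K₀ : IntermediateField F₀ L₀) (σ₀ : K₀ ≃ₐ[F₀] K₀) (φ₀ : (L₀ ≃ₐ[F₀] L₀) ≃* B p j 0)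
    (h₀ : IsIdentification K₀ σ₀ φ₀)
    (ξ : L) (hξ : IsPrimitiveRoot ξ p) (hL : IntermediateField.adjoin L₀ {ξ} = ⊤)
    (F : IntermediateField F₀ L) (hF : F = IntermediateField.adjoin F₀ {ξ})
    (K : IntermediateField F L)
    (hK : K = IntermediateField.adjoin F (algebraMap L₀ L '' (K₀ : Set L₀))) :
    ∃ (σ : K ≃ₐ[F] K) (φ : (L ≃ₐ[F] L) ≃* B p j 0),
      IsIdentification K σ φ ∧
      (∀ (x : K₀) (y : K), (y : L) = algebraMap L₀ L x → (σ y : L) = algebraMap L₀ L (σ₀ x)) ∧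
      (∀ (g : L ≃ₐ[F] L) (x : L₀),
        g (algebraMap L₀ L x) = algebraMap L₀ L (φ₀.symm (φ g) x)) ∧
      (EmbeddingSolvable hji 0 φ₀ ↔ EmbeddingSolvable hji 0 φ) ∧
      (∀ e : ZMod p, e ≠ 0 → (EmbeddingSolvable hji e φ₀ ↔ EmbeddingSolvable hji e φ)) := by
  have := h₀.finiteDimensional
  have := h₀.isGalois
  have hξint : IsIntegral L₀ ξ := (hξ.isIntegral (Fact.out : p.Prime).pos).tower_top
  have : FiniteDimensional L₀ L := by
    have h := IntermediateField.adjoin.finiteDimensional hξint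
    rw [hL] at h
    exact IntermediateField.topEquiv.toLinearEquiv.finiteDimensional
  have hgen : ∀ S : Subfield L, (∀ x, algebraMap L₀ L x ∈ S) → ξ ∈ S → ∀ y, y ∈ S := by
    intro S h1 h2 y
    have hy : y ∈ IntermediateField.adjoin L₀ {ξ} := hL ▸ IntermediateField.mem_top
    induction hy using IntermediateField.adjoin_induction with
    | mem x hx => rwa [Set.mem_singleton_iff.1 hx]
    | algebraMap x => exact h1 x
    | add x y _ _ hx hy => exact add_mem hx hy
    | inv x _ hx => exact inv_mem hx
    | mul x y _ _ hx hy => exact mul_mem hx hy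
  have hξF : ξ ∈ F := hF ▸ IntermediateField.mem_adjoin_simple_self F₀ ξ
  have : FiniteDimensional F₀ L := FiniteDimensional.trans F₀ L₀ L
  have hcop : (Module.finrank F₀ F).Coprime p := by
    rw [hF]
    exact coprime_finrank_adjoin_primitiveRoot hξ
  have hFGal : IsGalois F₀ F := by
    rw [hF]
    exact isGalois_adjoin_primitiveRoot hξ
  have hsep : Algebra.IsSeparable L₀ L := by
    have := (isGalois_adjoin_primitiveRoot (k := L₀) hξ)
    rw [hL, isGalois_iff_isGalois_top] at this
    infer_instance
  have : Algebra.IsSeparable F₀ L := Algebra.IsSeparable.trans F₀ L₀ L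
  have hext : ∀ g h : L ≃ₐ[F] L,
      (∀ x : L₀, g (algebraMap L₀ L x) = h (algebraMap L₀ L x)) → g = h := by
    intro g h hgh
    ext y
    refine hgen ((g : L →+* L).eqLocusField (h : L →+* L)) hgh ?_ y
    exact (g.commutes ⟨ξ, hξF⟩).trans (h.commutes ⟨ξ, hξF⟩).symm
  -- `L` is the compositum of the image of `L₀` and `F`, both normal over `F₀`.
  have hnormal : Normal F₀ L := by
    let E : IntermediateField F₀ L := (IsScalarTower.toAlgHom F₀ L₀ L).fieldRange
    have : Normal F₀ E :=
      Normal.of_algEquiv (AlgEquiv.ofInjectiveField (IsScalarTower.toAlgHom F₀ L₀ L))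
    have htop : E ⊔ F = ⊤ := by
      rw [eq_top_iff]
      intro y _
      exact hgen (E ⊔ F).toSubfield (fun x => (le_sup_left : E ≤ E ⊔ F) ⟨x, rfl⟩)
        ((le_sup_right : F ≤ E ⊔ F) hξF) y
    have h : Normal F₀ (E ⊔ F : IntermediateField F₀ L) := inferInstance
    rw [htop] at h
    exact Normal.of_algEquiv IntermediateField.topEquiv
  have : IsGalois F₀ L := { }
  have : IsGalois F L := IsGalois.tower_top_of_isGalois F₀ F L
  let r : (L ≃ₐ[F] L) →* (L₀ ≃ₐ[F₀] L₀) :=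
    (AlgEquiv.restrictNormalHom L₀).comp (AlgEquiv.restrictScalarsHom F₀)
  have hr : ∀ g x, g (algebraMap L₀ L x) = algebraMap L₀ L (r g x) := fun g x =>
    ((g.restrictScalars F₀).restrictNormal_commutes L₀ x).symm
  have hrinj : Function.Injective r := fun g h hgh => hext g h fun x => by rw [hr, hr, hgh]
  -- From `[L : F] * [F : F₀] = [L : L₀] * [L₀ : F₀]`, the order of `Gal(L₀/F₀)`, a power of `p` and
  -- so prime to `[F : F₀]`, divides that of `Gal(L/F)`.
  have hrbij : Function.Bijective r := by
    refine (Nat.bijective_iff_injective_and_card r).2 ⟨hrinj, ?_⟩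
    refine le_antisymm (Nat.card_le_card_of_injective r hrinj) (Nat.le_of_dvd Nat.card_pos ?_)
    have h1 : (Nat.card (L₀ ≃ₐ[F₀] L₀)).Coprime (Module.finrank F₀ F) := by
      obtain ⟨n, hn⟩ := IsPGroup.iff_card.1
        ((B.isPGroup (p := p) (i := j) (e := 0)).of_equiv φ₀.symm)
      rw [hn]
      exact hcop.symm.pow_left n
    refine h1.dvd_of_dvd_mul_left ?_
    rw [IsGalois.card_aut_eq_finrank, IsGalois.card_aut_eq_finrank, Module.finrank_mul_finrank,
      ← Module.finrank_mul_finrank F₀ L₀ L]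
    exact dvd_mul_right _ _
  let φ : (L ≃ₐ[F] L) ≃* B p j 0 := (MulEquiv.ofBijective r hrbij).trans φ₀
  have hφ : ∀ (g : L ≃ₐ[F] L) (x : L₀),
      g (algebraMap L₀ L x) = algebraMap L₀ L (φ₀.symm (φ g) x) := fun g x => by
    change _ = algebraMap L₀ L (φ₀.symm (φ₀ (r g)) x)
    rw [MulEquiv.symm_apply_apply, hr]
  obtain ⟨σ, hσ, hσx⟩ := IsIdentification.of_fixes_iff K φ fun g => by
    rw [IntermediateField.mem_fixingSubgroup_iff]
    refine Iff.trans ?_ (h₀.exp_eq_zero_iff (r g)).symm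
    constructor
    · intro hg x
      apply (algebraMap L₀ L).injective
      rw [← hr]
      exact hg _ (hK ▸ IntermediateField.subset_adjoin F _ ⟨x, x.2, rfl⟩)
    · intro hg y hy
      rw [hK] at hy
      induction hy using IntermediateField.adjoin_induction with
      | mem x hx =>
        obtain ⟨x, hx, rfl⟩ := hx
        rw [hr, hg ⟨x, hx⟩]
      | algebraMap x => exact g.commutes x
      | add x y _ _ hx hy => rw [map_add, hx, hy]
      | inv x _ hx => rw [map_inv₀, hx]
      | mul x y _ _ hx hy => rw [map_mul, hx, hy]
  have hiff : ∀ e : ZMod p, EmbeddingSolvable hji e φ₀ ↔ EmbeddingSolvable hji e φ := fun e =>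
    ⟨fun h => h.baseChange hj hji hφ, fun h => h.descend hj hji hφ hcop⟩
  refine ⟨σ, φ, hσ, ?_, hφ, hiff 0, fun e _ => hiff e⟩
  intro x y hxy
  -- `σ` is the restriction of the element of `Gal(L/F)` corresponding to `⟨0, 1⟩`; its counterpart
  -- over `F₀` has exponent `1` and so restricts to `σ₀` itself.
  have h1 := h₀.restrict (φ₀.symm ⟨0, 1⟩) x
  rw [hσx, hxy, hφ, MulEquiv.apply_symm_apply]
  rw [MulEquiv.apply_symm_apply, ZMod.val_one, pow_one] at h1
  rw [h1]
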